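/- Let $K$ be a field and $n\in\mathbb N$. For $A\subseteq\{1,\dots,n\}$ let $\mathcal I_A=(x_a : a\in A)\subseteq K[x_1,\dots,x_n]$ be the corresponding coordinate ideal and $V_A=\langle e_a : a\in A\rangle\subseteq K^n$ the corresponding coordinate subspace. Definitions. For a nonempty finite set $\mathcal G$ of nonzero subspaces of a $K$-vector space $V$, let $\mathcal C$ be the arrangement generated by $\mathcal G$, i.e. the smallest set of subspaces of $V$ that contains $\mathcal G$ and is closed under sums. A decomposition of $U\in\mathcal C$ is a direct sum $U=U_1\oplus\cdots\oplus U_k$ with $k\ge 2$ and all $U_i\in\mathcal C$, such that for every $A\in\mathcal C$ with $A\subseteq U$ each $A\cap U_i$ is zero or a member of $\mathcal C$, and $A=(A\cap U_1)\oplus\cdots\oplus(A\cap U_k)$; $U\in\mathcal C$ is irreducible if it has no decomposition. The set $\mathcal G$ is a building set if (a) all irreducible elements of $\mathcal C$ lie in $\mathcal G$, and (b) whenever $A,B\in\mathcal G$ and the sum $A+B$ is not direct, $A+B\in\mathcal G$. A set $\mathcal G$ of coordinate ideals of $K[x_1,\dots,x_n]$ is called a building set if the subspaces $V_A$ with $\mathcal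 I_A\in\mathcal G$ form a building set in $K^n$. A monomial ideal $\mathcal J\subseteq K[x_1,\dots,x_n]$ is called tame if the blowup of $\mathbb A^n_K$ with center $\mathcal J$, $\operatorname{Proj}\bigoplus_{i\ge 0}\mathcal J^i$, is smooth over $K$. Proposition. If $\mathcal G$ is a building set of monomial coordinate ideals in $K[x_1,\dots,x_n]$, then the product $\prod_{\mathcal I\in\mathcal G}\mathcal I$ is tame; that is, it is a monomial ideal and the blowup of $\mathbb A^n_K$ with center this ideal is smooth over $K$. -/

import Mathlib

namespace MonomialBlowup

open CategoryTheory

noncomputable section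

/-! ### Blowup of an affine scheme in an ideal -/

section Blowup

universe u

variable {R : Type u} [CommRing R]

/-- The degree `i` part `Iⁱ tⁱ` of the Rees algebra `R[It] = ⨁ᵢ Iⁱ tⁱ`. -/
def reesGrading (I : Ideal R) (i : ℕ) : Submodule R (reesAlgebra I) :=
  (LinearMap.range (Polynomial.monomial i : R →ₗ[R] Polynomial R)).comap
    (reesAlgebra I).val.toLinearMap

theorem mem_reesGrading_iff (I : Ideal R) (i : ℕ) (f : reesAlgebra I) :
    f ∈ reesGrading I i ↔ Polynomial.monomial i ((f : Polynomial R).coeff i) = f := by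
  constructor
  · rintro ⟨r, hr⟩
    have hr' : Polynomial.monomial i r = (f : Polynomial R) := hr
    rw [← hr', Polynomial.coeff_monomial, if_pos rfl]
  · intro h
    exact ⟨_, h⟩

/-- The homogeneous component of degree `i` of an element of the Rees algebra. -/
def reesComponent (I : Ideal R) (i : ℕ) (f : reesAlgebra I) : reesGrading I i :=
  ⟨⟨Polynomial.monomial i ((f : Polynomial R).coeff i), reesAlgebra.monomial_mem.mpr (f.2 i)⟩,
    ⟨_, rfl⟩⟩

theorem coeff_coeAddMonoidHom (I : Ideal R) (x : DirectSum ℕ fun i => reesGrading I i) (j : ℕ) :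
    ((DirectSum.coeAddMonoidHom (reesGrading I) x : reesAlgebra I) : Polynomial R).coeff j =
      ((x j : reesAlgebra I) : Polynomial R).coeff j := by
  classical
  induction x using DirectSum.induction_on with
  | zero => simp
  | of i y =>
    rw [DirectSum.coeAddMonoidHom_of]
    by_cases h : i = j
    · subst h
      rw [DirectSum.of_eq_same]
    · rw [DirectSum.of_eq_of_ne _ _ _ (Ne.symm h),
        ← (mem_reesGrading_iff I i y).mp y.2, Polynomial.coeff_monomial, if_neg h]
      simp
  | add x y hx hy => simp [hx, hy]

theorem coeAddMonoidHom_injective (I : Ideal R) :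
    Function.Injective (DirectSum.coeAddMonoidHom (reesGrading I)) := by
  intro x y hxy
  refine DFinsupp.ext fun j => Subtype.ext (Subtype.ext ?_)
  rw [← (mem_reesGrading_iff I j (x j)).mp (x j).2, ← (mem_reesGrading_iff I j (y j)).mp (y j).2,
    ← coeff_coeAddMonoidHom, ← coeff_coeAddMonoidHom, hxy]

theorem coe_sum_reesComponent (I : Ideal R) (f : reesAlgebra I) :
    DirectSum.coeAddMonoidHom (reesGrading I)
      (∑ i ∈ (f : Polynomial R).support,
        DirectSum.of (fun i => reesGrading I i) i (reesComponent I i f)) = f := by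
  refine Subtype.ext ?_
  rw [map_sum]
  simp only [DirectSum.coeAddMonoidHom_of, reesComponent, AddSubmonoidClass.coe_finsetSum]
  exact ((f : Polynomial R).as_sum_support).symm

instance reesGradedAlgebra (I : Ideal R) : GradedAlgebra (reesGrading I) where
  one_mem := ⟨1, rfl⟩
  mul_mem := by
    rintro i j f g ⟨r, hr⟩ ⟨s, hs⟩
    have hr' : Polynomial.monomial i r = (f : Polynomial R) := hr
    have hs' : Polynomial.monomial j s = (g : Polynomial R) := hs
    refine ⟨r * s, ?_⟩
    change _ = ((f * g : reesAlgebra I) : Polynomial R)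
    rw [MulMemClass.coe_mul, ← hr', ← hs', Polynomial.monomial_mul_monomial]
  decompose' f := ∑ i ∈ (f : Polynomial R).support,
    DirectSum.of (fun i => reesGrading I i) i (reesComponent I i f)
  left_inv := coe_sum_reesComponent I
  right_inv x := coeAddMonoidHom_injective I (coe_sum_reesComponent I _)

/-- The blowup of `Spec R` in the ideal `I`, i.e. `Proj` of the Rees algebra `⨁ᵢ Iⁱ`. -/
def blowup (I : Ideal R) : AlgebraicGeometry.Scheme.{u} :=
  AlgebraicGeometry.Proj (reesGrading I)

/-- The blowup map `π` from the blowup to `Spec R`. -/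
def blowupMap (I : Ideal R) : blowup I ⟶ AlgebraicGeometry.Spec (CommRingCat.of R) :=
  AlgebraicGeometry.Proj.toSpecZero (reesGrading I) ≫
    AlgebraicGeometry.Spec.map (CommRingCat.ofHom (algebraMap R (reesGrading I 0)))

end Blowup

/-! ### Tame monomial ideals -/

section Tame

universe u

variable {K : Type u} [Field K] {n : ℕ}

/-- A monomial ideal of `K[x₁, …, xₙ]`: an ideal generated by monomials. -/
def IsMonomialIdeal (I : Ideal (MvPolynomial (Fin n) K)) : Prop :=
  ∃ A : Set (Fin n →₀ ℕ), I = Ideal.span ((fun a => MvPolynomial.monomial a (1 : K)) '' A)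

/-- The structure morphism over `Spec K` of the blowup of `𝔸ⁿ` in `I`. -/
def blowupStructureMap (I : Ideal (MvPolynomial (Fin n) K)) :
    blowup I ⟶ AlgebraicGeometry.Spec (CommRingCat.of K) :=
  blowupMap I ≫
    AlgebraicGeometry.Spec.map (CommRingCat.ofHom (algebraMap K (MvPolynomial (Fin n) K)))

/-- A monomial ideal of `K[x₁, …, xₙ]` is tame if the blowup of `𝔸ⁿ` in it is smooth over `K`. -/
structure IsTame (I : Ideal (MvPolynomial (Fin n) K)) : Prop where
  isMonomialIdeal : IsMonomialIdeal I
  smooth : AlgebraicGeometry.Smooth (blowupStructureMap I)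

end Tame

/-! ### Building sets of linear subspaces -/

section BuildingSet

variable {K V : Type*} [Field K] [AddCommGroup V] [Module K V]

/-- `U` is the (internal) direct sum of the finite family of subspaces `W`. -/
def IsDirectSumOf (U : Submodule K V) {k : ℕ} (W : Fin k → Submodule K V) : Prop :=
  iSupIndep W ∧ ⨆ i, W i = U

/-- The arrangement generated by `G`: the smallest set of subspaces that contains `G` and is
closed under taking sums of two (equivalently, of finitely many and at least one) members. -/
def generatedArrangement (G : Set (Submodule K V)) : Set (Submodule K V) :=
  supClosure G

/-- A decomposition of `U` in the arrangement `C`: `U` is the direct sum of `k ≥ 2` members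
`W i` of `C`, and every member `A ⊆ U` of `C` is the direct sum of the `A ∩ W i`, each of which
is zero or a member of `C`. -/
structure IsDecomposition (C : Set (Submodule K V)) (U : Submodule K V) {k : ℕ}
    (W : Fin k → Submodule K V) : Prop where
  two_le : 2 ≤ k
  mem : ∀ i, W i ∈ C
  isDirectSumOf : IsDirectSumOf U W
  inter_mem : ∀ A ∈ C, A ≤ U → ∀ i, A ⊓ W i = ⊥ ∨ A ⊓ W i ∈ C
  inter_isDirectSumOf : ∀ A ∈ C, A ≤ U → IsDirectSumOf A fun i => A ⊓ W i

/-- A member of the arrangement `C` is irreducible if it has no decomposition in `C`. -/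
def IsIrreducibleIn (C : Set (Submodule K V)) (U : Submodule K V) : Prop :=
  U ∈ C ∧ ¬ ∃ (k : ℕ) (W : Fin k → Submodule K V), IsDecomposition C U W

/-- A building set: a nonempty finite set `G` of nonzero subspaces that contains the irreducible
members of the arrangement it generates, and that contains `A + B` whenever it contains `A` and
`B` and the sum `A + B` is not direct. -/
structure IsBuildingSet (G : Set (Submodule K V)) : Prop where
  nonempty : G.Nonempty
  finite : G.Finite
  ne_bot : ∀ U ∈ G, U ≠ ⊥
  irreducible_mem : ∀ U, IsIrreducibleIn (generatedArrangement G) U → U ∈ G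
  sup_mem : ∀ A ∈ G, ∀ B ∈ G, ¬ Disjoint A B → A ⊔ B ∈ G

end BuildingSet

/-! ### Building sets of coordinate ideals -/

section Coordinate

variable (K : Type*) [Field K] {n : ℕ}

/-- The coordinate ideal `(x_a : a ∈ A)` of `K[x₁, …, xₙ]`. -/
def coordinateIdeal (A : Finset (Fin n)) : Ideal (MvPolynomial (Fin n) K) :=
  Ideal.span (MvPolynomial.X '' (A : Set (Fin n)))

/-- The coordinate subspace of `Kⁿ` spanned by the standard basis vectors `e_a`, `a ∈ A`. -/
def coordinateSubspace (A : Finset (Fin n)) : Submodule K (Fin n → K) :=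
  Submodule.span K ((fun a => Pi.single a (1 : K)) '' (A : Set (Fin n)))

variable {K}

/-- A set of ideals is a building set of monomial coordinate ideals if its members are coordinate
ideals `(x_a : a ∈ A)` and the corresponding coordinate subspaces `⟨e_a : a ∈ A⟩` of `Kⁿ` form a
building set. -/
structure IsBuildingSetOfIdeals (G : Set (Ideal (MvPolynomial (Fin n) K))) : Prop where
  coordinate : ∀ I ∈ G, ∃ A : Finset (Fin n), I = coordinateIdeal K A
  isBuildingSet : IsBuildingSet
    {U : Submodule K (Fin n → K) | ∃ A : Finset (Fin n),
      coordinateIdeal K A ∈ G ∧ U = coordinateSubspace K A}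

end Coordinate

end

end MonomialBlowup

open CategoryTheory AlgebraicGeometry

namespace MonomialBlowup

universe u

/-- The degree one element `r t` of the Rees algebra. -/
noncomputable def reesDegOne {R : Type u} [CommRing R] {I : Ideal R} (r : I) : reesAlgebra I :=
  ⟨Polynomial.monomial 1 (r : R), reesAlgebra.monomial_mem.mpr (by simp)⟩

theorem reesDegOne_mem {R : Type u} [CommRing R] {I : Ideal R} (r : I) :
    reesDegOne r ∈ reesGrading I 1 := ⟨(r : R), rfl⟩

/-- The structure map from `K` to the degree zero part of the localized Rees algebra. -/
noncomputable def awayStructureMap {K : Type u} [Field K] {n : ℕ}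
    (I : Ideal (MvPolynomial (Fin n) K)) (f : reesAlgebra I) :
    K →+* HomogeneousLocalization.Away (reesGrading I) f :=
  ((HomogeneousLocalization.fromZeroRingHom (reesGrading I) (.powers f)).comp
    (algebraMap (MvPolynomial (Fin n) K) (reesGrading I 0))).comp
      (algebraMap K (MvPolynomial (Fin n) K))

/-- The structure map of `Proj` of the Rees algebra over `Spec K`. -/
noncomputable def projStructureMap {K : Type u} [Field K] {n : ℕ}
    (I : Ideal (MvPolynomial (Fin n) K)) : Proj (reesGrading I) ⟶ Spec (CommRingCat.of K) :=
  (Proj.toSpecZero (reesGrading I) ≫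
    Spec.map (CommRingCat.ofHom (algebraMap (MvPolynomial (Fin n) K) (reesGrading I 0)))) ≫
      Spec.map (CommRingCat.ofHom (algebraMap K (MvPolynomial (Fin n) K)))

theorem awayι_projStructureMap {K : Type u} [Field K] {n : ℕ}
    (I : Ideal (MvPolynomial (Fin n) K)) (r : I) :
    Proj.awayι (reesGrading I) (reesDegOne r) (reesDegOne_mem r) one_pos ≫ projStructureMap I =
      Spec.map (CommRingCat.ofHom (awayStructureMap I (reesDegOne r))) := by
  rw [projStructureMap, ← Category.assoc, ← Category.assoc, Proj.awayι_toSpecZero,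
    ← Spec.map_comp, ← Spec.map_comp]
  rfl

theorem monomial_succ_mem_of_reesDegOne_mem {R : Type u} [CommRing R] {I : Ideal R}
    {P : Ideal (reesAlgebra I)} (hP : ∀ r : I, reesDegOne r ∈ P) (i : ℕ) {s : R}
    (hs : s ∈ I ^ (i + 1)) :
    (⟨Polynomial.monomial (i + 1) s, reesAlgebra.monomial_mem.mpr hs⟩ : reesAlgebra I) ∈ P := by
  suffices H : ∃ h : Polynomial.monomial (i + 1) s ∈ reesAlgebra I,
      (⟨Polynomial.monomial (i + 1) s, h⟩ : reesAlgebra I) ∈ P from H.2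
  have hs' := hs
  rw [pow_succ] at hs
  refine Submodule.mul_induction_on hs (fun a ha b hb => ?_) ?_
  · refine ⟨reesAlgebra.monomial_mem.mpr (pow_succ I i ▸ Ideal.mul_mem_mul ha hb), ?_⟩
    convert P.mul_mem_left ⟨Polynomial.monomial i a, reesAlgebra.monomial_mem.mpr ha⟩ (hP ⟨b, hb⟩)
      using 1
    refine Subtype.ext ?_
    simp [reesDegOne, Polynomial.monomial_mul_monomial]
  · rintro x y ⟨hx, hx'⟩ ⟨hy, hy'⟩
    refine ⟨by rw [map_add]; exact add_mem hx hy, ?_⟩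
    convert P.add_mem hx' hy' using 1
    exact Subtype.ext (map_add _ _ _)

/-- Smoothness of a blowup can be checked on charts given by degree one elements, as soon as these
charts cover. -/
theorem smooth_blowupStructureMap {K : Type u} [Field K] {n : ℕ}
    (I : Ideal (MvPolynomial (Fin n) K)) (S : Set I)
    (hcover : ∀ P : Ideal (reesAlgebra I), P.IsPrime → (∀ r ∈ S, reesDegOne r ∈ P) →
      ∀ r : I, reesDegOne r ∈ P)
    (hsmooth : ∀ r ∈ S, (awayStructureMap I (reesDegOne r)).Smooth) :
    Smooth (blowupStructureMap I) := by
  change Smooth (projStructureMap I)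
  have : IsZariskiLocalAtSource @Smooth.{u} :=
    HasRingHomProperty.instIsZariskiLocalAtSource (Q := RingHom.Smooth)
  refine IsZariskiLocalAtSource.of_iSup_eq_top (P := @Smooth.{u})
    (fun r : S => Proj.basicOpen (reesGrading I) (reesDegOne r.1)) ?_ ?_
  · refine top_le_iff.mp fun x _ => TopologicalSpace.Opens.mem_iSup.mpr ?_
    by_contra! H
    simp only [Proj.mem_basicOpen, not_not] at H
    refine x.not_irrelevant_le ?_
    rw [HomogeneousIdeal.irrelevant_le]
    intro i hi f hf
    obtain ⟨j, rfl⟩ := Nat.exists_eq_succ_of_ne_zero hi.ne'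
    have h := monomial_succ_mem_of_reesDegOne_mem
      (hcover x.asHomogeneousIdeal.toIdeal x.isPrime fun r hr => H ⟨r, hr⟩) j (f.2 (j + 1))
    have e : (⟨Polynomial.monomial (j + 1) ((f : Polynomial _).coeff (j + 1)),
        reesAlgebra.monomial_mem.mpr (f.2 (j + 1))⟩ : reesAlgebra I) = f :=
      Subtype.ext ((mem_reesGrading_iff I _ f).mp hf)
    exact e ▸ h
  · intro r
    have h : (Proj.basicOpen (reesGrading I) (reesDegOne r.1)).ι =
        (Proj.basicOpenIsoSpec (reesGrading I) (reesDegOne r.1) (reesDegOne_mem r.1) one_pos).hom ≫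
          Proj.awayι (reesGrading I) (reesDegOne r.1) (reesDegOne_mem r.1) one_pos := by
      rw [← Proj.basicOpenIsoSpec_inv_ι, Iso.hom_inv_id_assoc]
    rw [h, Category.assoc, awayι_projStructureMap]
    have : Smooth (Spec.map (CommRingCat.ofHom (awayStructureMap I (reesDegOne r.1)))) :=
      (HasRingHomProperty.Spec_iff (P := @Smooth)).mpr (hsmooth r.1 r.2)
    exact smooth_comp _ _

section Chart

variable {K : Type u} [Field K] {n : ℕ} {I : Ideal (MvPolynomial (Fin n) K)} (r : I)
  {S : Type u} [CommRing S] [IsDomain S] [Algebra K S] (φ : MvPolynomial (Fin n) K →ₐ[K] S)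

/-- The extension `r t ↦ 1` of `φ` to the Rees algebra, with values in the fraction field. -/
noncomputable def reesEval : reesAlgebra I →+* FractionRing S :=
  (Polynomial.eval₂RingHom ((algebraMap S (FractionRing S)).comp φ.toRingHom)
    (algebraMap S (FractionRing S) (φ r))⁻¹).comp (reesAlgebra I).val.toRingHom

theorem reesEval_eq {i : ℕ} {x : reesAlgebra I} (hx : x ∈ reesGrading I i) :
    reesEval r φ x = algebraMap S (FractionRing S) (φ ((x : Polynomial (MvPolynomial (Fin n) K)).coeff i)) *
      (algebraMap S (FractionRing S) (φ r))⁻¹ ^ i := by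
  have h : (x : Polynomial (MvPolynomial (Fin n) K)) = Polynomial.monomial i ((x : Polynomial (MvPolynomial (Fin n) K)).coeff i) :=
    ((mem_reesGrading_iff I i x).mp hx).symm
  change Polynomial.eval₂ _ _ (x : Polynomial (MvPolynomial (Fin n) K)) = _
  conv_lhs => rw [h]
  rw [Polynomial.eval₂_monomial]
  rfl

variable {r φ}

theorem reesEval_reesDegOne_self (hr : φ r ≠ 0) : reesEval r φ (reesDegOne r) = 1 := by
  rw [reesEval_eq r φ (reesDegOne_mem r)]
  have : algebraMap S (FractionRing S) (φ r) ≠ 0 := by simpa using hr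
  simp [reesDegOne, this]

/-- The map from the chart of the blowup given by `r t` to the fraction field of `S`. -/
noncomputable def awayEval (hr : φ r ≠ 0) :
    HomogeneousLocalization.Away (reesGrading I) (reesDegOne r) →+* FractionRing S :=
  (IsLocalization.Away.lift (S := Localization.Away (reesDegOne r)) (reesDegOne r)
    (g := reesEval r φ) (by rw [reesEval_reesDegOne_self hr]; exact isUnit_one)).comp
    (algebraMap (HomogeneousLocalization.Away (reesGrading I) (reesDegOne r))
      (Localization.Away (reesDegOne r)))

theorem awayEval_mk (hr : φ r ≠ 0) (i : ℕ) (x : reesAlgebra I)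
    (hx : x ∈ reesGrading I (i • 1)) :
    awayEval hr (HomogeneousLocalization.Away.mk (reesGrading I) (reesDegOne_mem r) i x hx) =
      reesEval r φ x := by
  have h1 : awayEval hr
      (HomogeneousLocalization.Away.mk (reesGrading I) (reesDegOne_mem r) i x hx) =
      IsLocalization.Away.lift (S := Localization.Away (reesDegOne r)) (reesDegOne r)
        (g := reesEval r φ) (by rw [reesEval_reesDegOne_self hr]; exact isUnit_one)
        (Localization.mk x ⟨reesDegOne r ^ i, i, rfl⟩) := rfl
  rw [h1, Localization.mk_eq_mk', IsLocalization.Away.lift, IsLocalization.lift_mk'_spec]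
  simp [reesEval_reesDegOne_self hr]

theorem awayEval_injective (hφ : Function.Injective φ) (hr : φ r ≠ 0) :
    Function.Injective (awayEval hr) := by
  rw [injective_iff_map_eq_zero]
  intro a ha
  obtain ⟨i, x, hx, rfl⟩ :=
    HomogeneousLocalization.Away.mk_surjective (reesGrading I) (reesDegOne_mem r) a
  have hr' : algebraMap S (FractionRing S) (φ r) ≠ 0 := by simpa using hr
  rw [awayEval_mk, reesEval_eq r φ hx] at ha
  have h0 : (x : Polynomial (MvPolynomial (Fin n) K)).coeff (i • 1) = 0 := by
    rcases mul_eq_zero.mp ha with h | h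
    · exact hφ (by simpa using h)
    · exact absurd h (pow_ne_zero _ (inv_ne_zero hr'))
  have hx0 : x = 0 := Subtype.ext (by
    rw [← (mem_reesGrading_iff I _ x).mp hx, h0, map_zero]; rfl)
  exact HomogeneousLocalization.mk_eq_zero_of_num _ (Subtype.ext hx0)

theorem awayEval_mem_range (hr : φ r ≠ 0) (hI : I.map φ ≤ Ideal.span {φ r})
    (a : HomogeneousLocalization.Away (reesGrading I) (reesDegOne r)) :
    awayEval hr a ∈ (algebraMap S (FractionRing S)).range := by
  obtain ⟨i, x, hx, rfl⟩ :=
    HomogeneousLocalization.Away.mk_surjective (reesGrading I) (reesDegOne_mem r) a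
  have hr' : algebraMap S (FractionRing S) (φ r) ≠ 0 := by simpa using hr
  rw [awayEval_mk, reesEval_eq r φ hx]
  have h : φ ((x : Polynomial (MvPolynomial (Fin n) K)).coeff (i • 1)) ∈ Ideal.span {φ r ^ (i • 1)} := by
    rw [← Ideal.span_singleton_pow]
    refine Ideal.pow_right_mono hI (i • 1) ?_
    rw [← Ideal.map_pow]
    exact Ideal.mem_map_of_mem φ (x.2 (i • 1))
  obtain ⟨c, hc⟩ := Ideal.mem_span_singleton.mp h
  refine ⟨c, ?_⟩
  rw [hc, map_mul, map_pow, inv_pow]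
  field_simp

theorem algebraMap_mem_reesGrading_zero {R : Type u} [CommRing R] (J : Ideal R) (q : R) :
    algebraMap R (reesAlgebra J) q ∈ reesGrading J 0 := ⟨q, rfl⟩

theorem awayEval_comp_awayStructureMap (hr : φ r ≠ 0) :
    (awayEval hr).comp (awayStructureMap I (reesDegOne r)) =
      (algebraMap S (FractionRing S)).comp (algebraMap K S) := by
  ext k
  have h : awayStructureMap I (reesDegOne r) k =
      HomogeneousLocalization.Away.mk (reesGrading I) (reesDegOne_mem r) 0
        (algebraMap _ (reesAlgebra I) (MvPolynomial.C k))
        (algebraMap_mem_reesGrading_zero I (MvPolynomial.C k)) := by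
    refine HomogeneousLocalization.val_injective _ ?_
    rw [HomogeneousLocalization.Away.val_mk]
    simp only [pow_zero]
    rfl
  rw [RingHom.comp_apply, h, awayEval_mk, reesEval_eq r φ (i := 0)
    (algebraMap_mem_reesGrading_zero I (MvPolynomial.C k))]
  have h2 : ((algebraMap (MvPolynomial (Fin n) K) (reesAlgebra I) (MvPolynomial.C k) :
      reesAlgebra I) : Polynomial (MvPolynomial (Fin n) K)) = Polynomial.C (MvPolynomial.C k) := rfl
  rw [h2, Polynomial.coeff_C_zero, pow_zero, mul_one, ← MvPolynomial.algebraMap_eq, φ.commutes]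
  rfl

/-- If `φ` extends to an isomorphism from the chart of the blowup given by `r t` to a smooth
algebra, then this chart is smooth. -/
theorem smooth_awayStructureMap [Algebra.Smooth K S] (hφ : Function.Injective φ) (hr : φ r ≠ 0)
    (hI : I.map φ ≤ Ideal.span {φ r})
    (hgen : Algebra.adjoin K {s : S | ∃ p ∈ I, φ p = s * φ r} = ⊤) :
    (awayStructureMap I (reesDegOne r)).Smooth := by
  have hr' : algebraMap S (FractionRing S) (φ r) ≠ 0 := by simpa using hr
  let θ := (awayEval hr).codRestrict (algebraMap S (FractionRing S)).range
    (awayEval_mem_range hr hI)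
  let ι := (algebraMap S (FractionRing S)).rangeRestrict
  have hι : Function.Bijective ι :=
    ⟨fun a b h => IsFractionRing.injective S (FractionRing S) (congrArg Subtype.val h),
      RingHom.rangeRestrict_surjective _⟩
  have hcomp : θ.comp (awayStructureMap I (reesDegOne r)) = ι.comp (algebraMap K S) :=
    RingHom.ext fun k => Subtype.ext (RingHom.congr_fun (awayEval_comp_awayStructureMap hr) k)
  have hθ : Function.Bijective θ := by
    refine ⟨fun a b h => awayEval_injective hφ hr (congrArg Subtype.val h), ?_⟩
    suffices H : ∀ s : S, ∃ a, θ a = ι s by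
      intro y
      obtain ⟨s, rfl⟩ := hι.2 y
      exact H s
    intro s
    have hs : s ∈ Algebra.adjoin K {s : S | ∃ p ∈ I, φ p = s * φ r} := hgen ▸ trivial
    induction hs using Algebra.adjoin_induction with
    | mem s hs =>
      obtain ⟨p, hp, hps⟩ := hs
      refine ⟨HomogeneousLocalization.Away.mk (reesGrading I) (reesDegOne_mem r) 1
        (reesDegOne ⟨p, hp⟩) (reesDegOne_mem _), Subtype.ext ?_⟩
      change awayEval hr _ = algebraMap S (FractionRing S) s
      rw [awayEval_mk, reesEval_eq r φ (reesDegOne_mem _)]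
      simp [reesDegOne, hps, hr']
    | algebraMap k => exact ⟨_, RingHom.congr_fun hcomp k⟩
    | add x y _ _ hx hy =>
      obtain ⟨a, ha⟩ := hx
      obtain ⟨b, hb⟩ := hy
      exact ⟨a + b, by rw [map_add, map_add, ha, hb]⟩
    | mul x y _ _ hx hy =>
      obtain ⟨a, ha⟩ := hx
      obtain ⟨b, hb⟩ := hy
      exact ⟨a * b, by rw [map_mul, map_mul, ha, hb]⟩
  let e := RingEquiv.ofBijective θ hθ
  have h : awayStructureMap I (reesDegOne r) =
      (e.symm : _ →+* _).comp (ι.comp (algebraMap K S)) := by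
    rw [← hcomp]
    refine RingHom.ext fun k => ?_
    exact (e.symm_apply_apply _).symm
  rw [h]
  exact ((RingHom.smooth_algebraMap.mpr inferInstance).comp (.of_bijective hι)).comp
    (.of_bijective e.symm.bijective)

end Chart

section Forest

variable {K : Type u} [Field K] {σ : Type*} [Fintype σ] (r : σ → σ → Prop)

open Classical in
/-- The monomial substitution sending `xᵢ` to the product of all `xⱼ` with `j` above `i`. -/
noncomputable def upperSubst (K : Type u) [Field K] : MvPolynomial σ K →ₐ[K] MvPolynomial σ K :=
  MvPolynomial.aeval fun i => ∏ j with r i j, MvPolynomial.X j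

open Classical in
theorem upperSubst_X (i : σ) :
    upperSubst r K (MvPolynomial.X i) = ∏ j with r i j, MvPolynomial.X j :=
  MvPolynomial.aeval_X _ _

open Classical in
/-- The action of `upperSubst` on exponents. -/
noncomputable def upperExponent (a : σ →₀ ℕ) : σ →₀ ℕ :=
  Finsupp.equivFunOnFinite.symm fun j => ∑ i with r i j, a i

theorem upperSubst_monomial (a : σ →₀ ℕ) (c : K) :
    upperSubst r K (MvPolynomial.monomial a c) =
      MvPolynomial.monomial (upperExponent r a) c := by
  classical
  rw [MvPolynomial.monomial_eq, MvPolynomial.monomial_eq, map_mul, ← MvPolynomial.algebraMap_eq,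
    AlgHom.commutes]
  congr 1
  rw [Finsupp.prod_fintype _ _ (by simp), Finsupp.prod_fintype _ _ (by simp), map_prod]
  simp only [map_pow, upperSubst_X, ← Finset.prod_pow, upperExponent,
    Finsupp.equivFunOnFinite_symm_apply_apply, ← Finset.prod_pow_eq_pow_sum, Finset.prod_filter]
  rw [Finset.prod_comm]
  refine Finset.prod_congr rfl fun j _ => Finset.prod_congr rfl fun i _ => ?_
  split_ifs <;> simp

variable {r}

theorem upperExponent_injective (hrefl : ∀ i, r i i) (htrans : ∀ i j k, r i j → r j k → r i k)
    (hanti : ∀ i j, r i j → r j i → i = j) : Function.Injective (upperExponent r) := by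
  classical
  intro a b hab
  suffices H : ∀ m, ∀ j, (Finset.univ.filter fun i => r i j).card = m → a j = b j from
    Finsupp.ext fun j => H _ j rfl
  intro m
  induction m using Nat.strong_induction_on with
  | _ m ih =>
    intro j hj
    have h : ∑ i with r i j, a i = ∑ i with r i j, b i := DFunLike.congr_fun hab j
    have hmem : j ∈ Finset.univ.filter fun i => r i j := by simp [hrefl]
    rw [← Finset.add_sum_erase _ _ hmem, ← Finset.add_sum_erase _ _ hmem] at h
    have h' : ∑ i ∈ (Finset.univ.filter fun i => r i j).erase j, a i =
        ∑ i ∈ (Finset.univ.filter fun i => r i j).erase j, b i := by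
      refine Finset.sum_congr rfl fun i hi => ?_
      obtain ⟨hij, hi⟩ := Finset.mem_erase.mp hi
      have hi : r i j := by simpa using hi
      refine ih _ (hj ▸ Finset.card_lt_card ?_) i rfl
      refine Finset.ssubset_iff_subset_ne.mpr ⟨fun k hk => ?_, fun he => hij ?_⟩
      · simp only [Finset.mem_filter, Finset.mem_univ, true_and] at hk ⊢
        exact htrans _ _ _ hk hi
      · rw [← he] at hmem
        exact hanti _ _ hi (by simpa using hmem)
    omega

theorem upperSubst_injective (hrefl : ∀ i, r i i) (htrans : ∀ i j k, r i j → r j k → r i k)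
    (hanti : ∀ i j, r i j → r j i → i = j) : Function.Injective (upperSubst r K) := by
  classical
  have hinj := upperExponent_injective hrefl htrans hanti
  rw [injective_iff_map_eq_zero]
  intro p hp
  ext d
  have h : (upperSubst r K p).coeff (upperExponent r d) = p.coeff d := by
    conv_lhs => rw [p.as_sum, map_sum, MvPolynomial.coeff_sum]
    simp only [upperSubst_monomial, MvPolynomial.coeff_monomial, hinj.eq_iff]
    simp [eq_comm]
  rw [← h, hp, MvPolynomial.coeff_zero, MvPolynomial.coeff_zero]

theorem upperSubst_X_dvd (htrans : ∀ i j k, r i j → r j k → r i k) {i j : σ} (h : r i j) :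
    upperSubst r K (MvPolynomial.X j) ∣ upperSubst r K (MvPolynomial.X i) := by
  classical
  rw [upperSubst_X, upperSubst_X]
  refine Finset.prod_dvd_prod_of_subset _ _ _ fun k hk => ?_
  simp only [Finset.mem_filter, Finset.mem_univ, true_and] at hk ⊢
  exact htrans _ _ _ h hk

theorem upperSubst_X_ne_zero (i : σ) : upperSubst r K (MvPolynomial.X i) ≠ 0 := by
  classical
  rw [upperSubst_X]
  exact Finset.prod_ne_zero_iff.mpr fun j _ => MvPolynomial.X_ne_zero j

/-- If the elements above any element form a chain, each variable is the image of a variable or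
a quotient of two such images. -/
theorem upperSubst_X_eq (hrefl : ∀ i, r i i) (htrans : ∀ i j k, r i j → r j k → r i k)
    (hanti : ∀ i j, r i j → r j i → i = j) (hchain : ∀ i j k, r i j → r i k → r j k ∨ r k j)
    (i : σ) :
    upperSubst r K (MvPolynomial.X i) = MvPolynomial.X i ∨
      ∃ j, j ≠ i ∧ r i j ∧ upperSubst r K (MvPolynomial.X i) =
        MvPolynomial.X i * upperSubst r K (MvPolynomial.X j) := by
  classical
  by_cases hmax : ∀ j, r i j → j = i
  · left
    have h : (Finset.univ.filter fun j => r i j) = {i} := by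
      ext j
      simp only [Finset.mem_filter, Finset.mem_univ, true_and, Finset.mem_singleton]
      exact ⟨hmax j, fun h => h ▸ hrefl j⟩
    rw [upperSubst_X, h, Finset.prod_singleton]
  · right
    push Not at hmax
    obtain ⟨j₀, hj₀, hj₀i⟩ := hmax
    obtain ⟨j, hj, hjmax⟩ := (Finset.univ.filter fun j => r i j ∧ j ≠ i).exists_max_image
      (fun j => (Finset.univ.filter fun k => r j k).card) ⟨j₀, by simp [hj₀, hj₀i]⟩
    simp only [Finset.mem_filter, Finset.mem_univ, true_and] at hj hjmax
    refine ⟨j, hj.2, hj.1, ?_⟩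
    have h : (Finset.univ.filter fun k => r i k) = insert i (Finset.univ.filter fun k => r j k) := by
      ext k
      simp only [Finset.mem_filter, Finset.mem_univ, true_and, Finset.mem_insert]
      constructor
      · intro hk
        by_cases hki : k = i
        · exact Or.inl hki
        right
        rcases hchain i j k hj.1 hk with hjk | hkj
        · exact hjk
        · have hsub : (Finset.univ.filter fun l => r j l) ⊆ Finset.univ.filter fun l => r k l := by
            intro l hl
            simp only [Finset.mem_filter, Finset.mem_univ, true_and] at hl ⊢
            exact htrans _ _ _ hkj hl
          have heq := Finset.eq_of_subset_of_card_le hsub (hjmax k ⟨hk, hki⟩)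
          have : k ∈ Finset.univ.filter fun l => r j l := by rw [heq]; simp [hrefl]
          simpa using this
      · rintro (rfl | hk)
        · exact hrefl _
        · exact htrans _ _ _ hj.1 hk
    rw [upperSubst_X, h, Finset.prod_insert, upperSubst_X]
    simp only [Finset.mem_filter, Finset.mem_univ, true_and]
    exact fun hji => hj.2 (hanti _ _ hji hj.1)

end Forest

section Choice

variable {α : Type*}

/-- `f` selects an element of every member of `𝒢`. -/
def IsChoice (𝒢 : Finset (Finset α)) (f : Finset α → α) : Prop := ∀ A ∈ 𝒢, f A ∈ A

/-- A selection of elements that is independent of irrelevant alternatives. -/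
structure IsConsistentChoice (𝒢 : Finset (Finset α)) (f : Finset α → α) : Prop where
  isChoice : IsChoice 𝒢 f
  eq_of_subset : ∀ A ∈ 𝒢, ∀ B ∈ 𝒢, A ⊆ B → f B ∈ A → f A = f B

/-- The relation in which the element selected from a member of `𝒢` is above all its elements. -/
def choiceRel (𝒢 : Finset (Finset α)) (f : Finset α → α) (i j : α) : Prop :=
  i = j ∨ ∃ A ∈ 𝒢, i ∈ A ∧ f A = j

variable {𝒢 : Finset (Finset α)} {f : Finset α → α}

theorem choiceRel_refl (i : α) : choiceRel 𝒢 f i i := Or.inl rfl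

variable [DecidableEq α]

theorem IsChoice.update (hf : IsChoice 𝒢 f) {A : Finset α} {a : α} (ha : a ∈ A) :
    IsChoice 𝒢 (Function.update f A a) := by
  intro B hB
  by_cases h : B = A
  · subst h
    simpa using ha
  · simpa [h] using hf B hB

@[to_additive]
theorem prod_update_mul {M : Type*} [CommMonoid M] (h : α → M) {A : Finset α} (hA : A ∈ 𝒢)
    (a : α) : (∏ B ∈ 𝒢, h (Function.update f A a B)) * h (f A) = (∏ B ∈ 𝒢, h (f B)) * h a := by
  rw [← Finset.prod_erase_mul _ _ hA, ← Finset.prod_erase_mul _ _ hA, Function.update_self,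
    mul_right_comm]
  congr 2
  refine Finset.prod_congr rfl fun B hB => ?_
  rw [Function.update_of_ne (Finset.ne_of_mem_erase hB)]

theorem IsConsistentChoice.union_eq (hf : IsConsistentChoice 𝒢 f)
    {A B : Finset α} (hA : A ∈ 𝒢) (hB : B ∈ 𝒢) (hAB : A ∪ B ∈ 𝒢) :
    f A = f (A ∪ B) ∨ f B = f (A ∪ B) := by
  rcases Finset.mem_union.mp (hf.isChoice _ hAB) with h | h
  · exact Or.inl (hf.eq_of_subset _ hA _ hAB Finset.subset_union_left h)
  · exact Or.inr (hf.eq_of_subset _ hB _ hAB Finset.subset_union_right h)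

variable (hU : ∀ A ∈ 𝒢, ∀ B ∈ 𝒢, ¬ Disjoint A B → A ∪ B ∈ 𝒢) (hf : IsConsistentChoice 𝒢 f)

include hU hf

theorem choiceRel_trans (i j k : α) (hij : choiceRel 𝒢 f i j) (hjk : choiceRel 𝒢 f j k) :
    choiceRel 𝒢 f i k := by
  rcases hij with rfl | ⟨A, hA, hiA, hj⟩
  · exact hjk
  rcases hjk with rfl | ⟨B, hB, hjB, hk⟩
  · exact Or.inr ⟨A, hA, hiA, hj⟩
  have hjA : j ∈ A := hj ▸ hf.isChoice A hA
  have hAB := hU A hA B hB (Finset.not_disjoint_iff.mpr ⟨j, hjA, hjB⟩)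
  rcases hf.union_eq hA hB hAB with h | h
  · have h2 := hf.eq_of_subset B hB _ hAB Finset.subset_union_right (by rw [← h, hj]; exact hjB)
    exact Or.inr ⟨A, hA, hiA, by rw [h, ← h2, hk]⟩
  · exact Or.inr ⟨A ∪ B, hAB, Finset.mem_union_left _ hiA, by rw [← h, hk]⟩

theorem choiceRel_antisymm (i j : α) (hij : choiceRel 𝒢 f i j) (hji : choiceRel 𝒢 f j i) :
    i = j := by
  rcases hij with rfl | ⟨A, hA, hiA, hj⟩
  · rfl
  rcases hji with rfl | ⟨B, hB, hjB, hi⟩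
  · rfl
  have hjA : j ∈ A := hj ▸ hf.isChoice A hA
  have hAB := hU A hA B hB (Finset.not_disjoint_iff.mpr ⟨j, hjA, hjB⟩)
  rcases hf.union_eq hA hB hAB with h | h
  · have h2 := hf.eq_of_subset B hB _ hAB Finset.subset_union_right (by rw [← h, hj]; exact hjB)
    rw [← hi, h2, ← h, hj]
  · have h2 := hf.eq_of_subset A hA _ hAB Finset.subset_union_left (by rw [← h, hi]; exact hiA)
    rw [← hj, h2, ← h, hi]

theorem choiceRel_chain (i j k : α) (hij : choiceRel 𝒢 f i j) (hik : choiceRel 𝒢 f i k) :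
    choiceRel 𝒢 f j k ∨ choiceRel 𝒢 f k j := by
  rcases hij with rfl | ⟨A, hA, hiA, hj⟩
  · exact Or.inl hik
  rcases hik with rfl | ⟨B, hB, hiB, hk⟩
  · exact Or.inr (Or.inr ⟨A, hA, hiA, hj⟩)
  have hjA : j ∈ A := hj ▸ hf.isChoice A hA
  have hkB : k ∈ B := hk ▸ hf.isChoice B hB
  have hAB := hU A hA B hB (Finset.not_disjoint_iff.mpr ⟨i, hiA, hiB⟩)
  rcases hf.union_eq hA hB hAB with h | h
  · exact Or.inr (Or.inr ⟨_, hAB, Finset.mem_union_right _ hkB, by rw [← h, hj]⟩)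
  · exact Or.inl (Or.inr ⟨_, hAB, Finset.mem_union_left _ hjA, by rw [← h, hk]⟩)

end Choice

variable {K : Type u} [Field K] {n : ℕ} {𝒢 : Finset (Finset (Fin n))}

/-- The monomial picking the variable `x_{f A}` from each `A ∈ 𝒢`. -/
noncomputable def choiceMonomial (K : Type u) [Field K] (𝒢 : Finset (Finset (Fin n)))
    (f : Finset (Fin n) → Fin n) : MvPolynomial (Fin n) K :=
  ∏ A ∈ 𝒢, MvPolynomial.X (f A)

theorem choiceMonomial_update_mul_X {f : Finset (Fin n) → Fin n} {A : Finset (Fin n)} (hA : A ∈ 𝒢)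
    (a : Fin n) :
    choiceMonomial K 𝒢 (Function.update f A a) * MvPolynomial.X (f A) =
      choiceMonomial K 𝒢 f * MvPolynomial.X a :=
  prod_update_mul (fun i => (MvPolynomial.X i : MvPolynomial (Fin n) K)) hA a

theorem prod_coordinateIdeal [Nonempty (Fin n)] :
    ∏ A ∈ 𝒢, coordinateIdeal K A =
      Ideal.span (choiceMonomial K 𝒢 '' {f | IsChoice 𝒢 f}) := by
  classical
  simp only [coordinateIdeal]
  rw [Ideal.prod_span]
  congr 1
  ext p
  rw [Set.mem_finsetProd]
  constructor
  · rintro ⟨g, hg, rfl⟩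
    have h : ∀ A, ∃ i, A ∈ 𝒢 → i ∈ A ∧ MvPolynomial.X i = g A := by
      intro A
      by_cases hA : A ∈ 𝒢
      · obtain ⟨i, hi, hig⟩ := hg hA
        exact ⟨i, fun _ => ⟨hi, hig⟩⟩
      · exact ⟨Classical.arbitrary _, fun h => absurd h hA⟩
    choose f hf using h
    exact ⟨f, fun A hA => (hf A hA).1, Finset.prod_congr rfl fun A hA => (hf A hA).2⟩
  · rintro ⟨f, hf, rfl⟩
    exact ⟨fun A => MvPolynomial.X (f A), fun {A} hA => ⟨f A, hf A hA, rfl⟩, rfl⟩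

theorem choiceMonomial_mem (f : Finset (Fin n) → Fin n) (hf : IsChoice 𝒢 f) :
    choiceMonomial K 𝒢 f ∈ ∏ A ∈ 𝒢, coordinateIdeal K A :=
  Ideal.prod_mem_prod fun A hA => Ideal.subset_span ⟨f A, hf A hA, rfl⟩

theorem choiceMonomial_eq_monomial (f : Finset (Fin n) → Fin n) :
    choiceMonomial K 𝒢 f = MvPolynomial.monomial (∑ A ∈ 𝒢, Finsupp.single (f A) 1) 1 := by
  rw [choiceMonomial, MvPolynomial.monomial_sum_one]
  rfl

theorem isMonomialIdeal_prod_coordinateIdeal [Nonempty (Fin n)] :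
    IsMonomialIdeal (∏ A ∈ 𝒢, coordinateIdeal K A) := by
  refine ⟨(fun f : Finset (Fin n) → Fin n => ∑ A ∈ 𝒢, Finsupp.single (f A) 1) ''
    {f | IsChoice 𝒢 f}, ?_⟩
  rw [prod_coordinateIdeal, Set.image_image]
  simp only [choiceMonomial_eq_monomial]

/-- The charts given by consistent choices cover the blowup. -/
theorem reesDegOne_mem_of_consistent [Nonempty (Fin n)]
    (P : Ideal (reesAlgebra (∏ A ∈ 𝒢, coordinateIdeal K A))) (hP : P.IsPrime)
    (h : ∀ f, ∀ hf : IsConsistentChoice 𝒢 f,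
      reesDegOne ⟨choiceMonomial K 𝒢 f, choiceMonomial_mem f hf.isChoice⟩ ∈ P)
    (r : ↥(∏ A ∈ 𝒢, coordinateIdeal K A)) : reesDegOne r ∈ P := by
  classical
  suffices H : ∀ s, ∀ f, ∀ hf : IsChoice 𝒢 f, ∑ A ∈ 𝒢, (f A : ℕ) = s →
      reesDegOne ⟨choiceMonomial K 𝒢 f, choiceMonomial_mem f hf⟩ ∈ P by
    obtain ⟨r, hr⟩ := r
    have hr' := hr
    rw [prod_coordinateIdeal] at hr'
    suffices H' : ∃ h : r ∈ ∏ A ∈ 𝒢, coordinateIdeal K A, reesDegOne ⟨r, h⟩ ∈ P from H'.2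
    clear hr
    induction hr' using Submodule.span_induction with
    | mem p hp =>
      obtain ⟨f, hf, rfl⟩ := hp
      exact ⟨_, H _ f hf rfl⟩
    | zero =>
      refine ⟨zero_mem _, ?_⟩
      convert P.zero_mem
      exact Subtype.ext (map_zero _)
    | add x y _ _ hx hy =>
      refine ⟨add_mem hx.1 hy.1, ?_⟩
      convert P.add_mem hx.2 hy.2
      exact Subtype.ext (map_add _ _ _)
    | smul a x _ hx =>
      refine ⟨Ideal.mul_mem_left _ a hx.1, ?_⟩
      convert P.mul_mem_left (algebraMap _ _ a) hx.2
      refine Subtype.ext ?_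
      change Polynomial.monomial 1 (a * x) = Polynomial.C a * Polynomial.monomial 1 x
      rw [Polynomial.C_mul_monomial]
  intro s
  induction s using Nat.strong_induction_on with
  | _ s ih =>
    intro f hf hs
    by_cases hcons : ∀ A ∈ 𝒢, ∀ B ∈ 𝒢, A ⊆ B → f B ∈ A → f A = f B
    · exact h f ⟨hf, hcons⟩
    push Not at hcons
    obtain ⟨A, hA, B, hB, hAB, hBA, hne⟩ := hcons
    have hf₁ : IsChoice 𝒢 (Function.update f A (f B)) := hf.update hBA
    have hf₂ : IsChoice 𝒢 (Function.update f B (f A)) := hf.update (hAB (hf A hA))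
    have hmul : choiceMonomial K 𝒢 (Function.update f A (f B)) *
        choiceMonomial K 𝒢 (Function.update f B (f A)) =
          choiceMonomial K 𝒢 f * choiceMonomial K 𝒢 f := by
      have h₁ := choiceMonomial_update_mul_X (K := K) (f := f) hA (f B)
      have h₂ := choiceMonomial_update_mul_X (K := K) (f := f) hB (f A)
      refine mul_right_cancel₀ (mul_ne_zero (MvPolynomial.X_ne_zero (R := K) (f A))
        (MvPolynomial.X_ne_zero (f B))) ?_
      linear_combination (choiceMonomial K 𝒢 (Function.update f B (f A)) *
        MvPolynomial.X (f B)) * h₁ + (choiceMonomial K 𝒢 f * MvPolynomial.X (f B)) * h₂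
    have hrees : reesDegOne ⟨_, choiceMonomial_mem (K := K) _ hf₁⟩ *
        reesDegOne ⟨_, choiceMonomial_mem (K := K) _ hf₂⟩ =
        reesDegOne ⟨_, choiceMonomial_mem (K := K) _ hf⟩ *
          reesDegOne ⟨_, choiceMonomial_mem (K := K) _ hf⟩ := by
      refine Subtype.ext ?_
      change Polynomial.monomial 1 _ * Polynomial.monomial 1 _ =
        Polynomial.monomial 1 _ * Polynomial.monomial 1 _
      rw [Polynomial.monomial_mul_monomial, Polynomial.monomial_mul_monomial, hmul]
    have hs₁ := sum_update_add (f := f) (fun i : Fin n => (i : ℕ)) hA (f B)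
    have hs₂ := sum_update_add (f := f) (fun i : Fin n => (i : ℕ)) hB (f A)
    have hne' : (f A : ℕ) ≠ f B := fun h => hne (Fin.ext h)
    refine (hP.mem_or_mem (?_ : _ * _ ∈ P)).elim id id
    rw [← hrees]
    rcases lt_or_gt_of_ne hne' with hlt | hlt
    · exact P.mul_mem_left _ (ih _ (by omega) _ hf₂ rfl)
    · exact P.mul_mem_right _ (ih _ (by omega) _ hf₁ rfl)

/-- The chart of the blowup given by a consistent choice is an affine space. -/
theorem smooth_awayStructureMap_of_consistent [Nonempty (Fin n)]
    (hU : ∀ A ∈ 𝒢, ∀ B ∈ 𝒢, ¬ Disjoint A B → A ∪ B ∈ 𝒢)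
    {f : Finset (Fin n) → Fin n} (hf : IsConsistentChoice 𝒢 f) :
    (awayStructureMap _ (reesDegOne
      ⟨choiceMonomial K 𝒢 f, choiceMonomial_mem f hf.isChoice⟩)).Smooth := by
  have hrefl := choiceRel_refl (𝒢 := 𝒢) (f := f)
  have htrans := choiceRel_trans hU hf
  have hanti := choiceRel_antisymm hU hf
  have hchain := choiceRel_chain hU hf
  have hne : choiceMonomial K 𝒢 f ≠ 0 :=
    Finset.prod_ne_zero_iff.mpr fun A _ => MvPolynomial.X_ne_zero (f A)
  have hinj : Function.Injective (upperSubst (choiceRel 𝒢 f) K) :=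
    upperSubst_injective hrefl htrans hanti
  have : Algebra.Smooth K (MvPolynomial (Fin n) K) := ⟨inferInstance, inferInstance⟩
  refine smooth_awayStructureMap (S := MvPolynomial (Fin n) K)
    (φ := upperSubst (choiceRel 𝒢 f) K) hinj ?_ ?_ ?_
  · exact fun h0 => hne (hinj (h0.trans (map_zero _).symm))
  · change _ ≤ Ideal.span {upperSubst (choiceRel 𝒢 f) K (choiceMonomial K 𝒢 f)}
    rw [prod_coordinateIdeal, Ideal.map_span, Ideal.span_le]
    rintro _ ⟨_, ⟨g, hg, rfl⟩, rfl⟩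
    refine Ideal.mem_span_singleton.mpr ?_
    simp only [choiceMonomial, map_prod]
    exact Finset.prod_dvd_prod_of_dvd _ _ fun A hA =>
      upperSubst_X_dvd htrans (Or.inr ⟨A, hA, hg A hA, rfl⟩)
  · rw [eq_top_iff, ← MvPolynomial.adjoin_range_X]
    refine Algebra.adjoin_mono ?_
    rintro _ ⟨i, rfl⟩
    rcases upperSubst_X_eq (K := K) hrefl htrans hanti hchain i with h | ⟨j, hji, hij, h⟩
    · exact ⟨MvPolynomial.X i * choiceMonomial K 𝒢 f,
        Ideal.mul_mem_left _ _ (choiceMonomial_mem f hf.isChoice), by rw [map_mul, h]⟩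
    · obtain rfl | ⟨A, hA, hiA, rfl⟩ := hij
      · exact absurd rfl hji
      refine ⟨choiceMonomial K 𝒢 (Function.update f A i),
        choiceMonomial_mem _ (hf.isChoice.update hiA), ?_⟩
      refine mul_right_cancel₀ (upperSubst_X_ne_zero (r := choiceRel 𝒢 f) (f A)) ?_
      rw [← map_mul, choiceMonomial_update_mul_X hA, map_mul, h]
      ring

theorem isTame_prod_coordinateIdeal [Nonempty (Fin n)]
    (hU : ∀ A ∈ 𝒢, ∀ B ∈ 𝒢, ¬ Disjoint A B → A ∪ B ∈ 𝒢) :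
    IsTame (∏ A ∈ 𝒢, coordinateIdeal K A) where
  isMonomialIdeal := isMonomialIdeal_prod_coordinateIdeal
  smooth := by
    refine smooth_blowupStructureMap _ {r | ∃ f, ∃ hf : IsConsistentChoice 𝒢 f,
      r = ⟨choiceMonomial K 𝒢 f, choiceMonomial_mem f hf.isChoice⟩} ?_ ?_
    · exact fun P hP hS => reesDegOne_mem_of_consistent P hP
        fun f hf => hS _ ⟨f, hf, rfl⟩
    · rintro _ ⟨f, hf, rfl⟩
      exact smooth_awayStructureMap_of_consistent hU hf

theorem mem_coordinateSubspace_iff {L : Type*} [Field L] (A : Finset (Fin n)) (v : Fin n → L) :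
    v ∈ coordinateSubspace L A ↔ ∀ i ∉ A, v i = 0 := by
  constructor
  · intro hv i hi
    have hle : coordinateSubspace L A ≤
        LinearMap.ker (LinearMap.proj (R := L) (φ := fun _ => L) i) := by
      refine Submodule.span_le.mpr ?_
      rintro _ ⟨a, ha, rfl⟩
      have : i ≠ a := fun h => hi (h ▸ ha)
      simp [this]
    exact hle hv
  · intro hv
    rw [← Finset.univ_sum_single v]
    refine Submodule.sum_mem _ fun i _ => ?_
    by_cases hi : i ∈ A
    · have : Pi.single i (v i) = v i • (Pi.single i 1 : Fin n → L) := by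
        rw [← Pi.single_smul, smul_eq_mul, mul_one]
      rw [this]
      exact Submodule.smul_mem _ _ (Submodule.subset_span ⟨i, hi, rfl⟩)
    · rw [hv i hi, Pi.single_zero]
      exact zero_mem _

theorem single_mem_coordinateSubspace_iff (A : Finset (Fin n)) (i : Fin n) :
    (Pi.single i 1 : Fin n → K) ∈ coordinateSubspace K A ↔ i ∈ A := by
  rw [mem_coordinateSubspace_iff]
  constructor
  · intro h
    by_contra hi
    simpa using h i hi
  · intro hi j hj
    have : j ≠ i := fun h => hj (h ▸ hi)
    simp [this]

theorem coordinateSubspace_injective :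
    Function.Injective (coordinateSubspace K : Finset (Fin n) → _) := by
  intro A B h
  ext i
  rw [← single_mem_coordinateSubspace_iff (K := K), h, single_mem_coordinateSubspace_iff]

theorem coordinateSubspace_union (A B : Finset (Fin n)) :
    coordinateSubspace K (A ∪ B) = coordinateSubspace K A ⊔ coordinateSubspace K B := by
  rw [coordinateSubspace, Finset.coe_union, Set.image_union, Submodule.span_union]
  rfl

theorem coordinateIdeal_injective :
    Function.Injective (coordinateIdeal K : Finset (Fin n) → _) := by
  intro A B h
  have key : ∀ (A : Finset (Fin n)) i, (MvPolynomial.X i : MvPolynomial (Fin n) K) ∈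
      coordinateIdeal K A ↔ i ∈ A := by
    intro A i
    rw [coordinateIdeal, MvPolynomial.mem_ideal_span_X_image]
    simp [MvPolynomial.support_X, Finsupp.single_apply]
  ext i
  rw [← key A, h, key B]

end MonomialBlowup

open MonomialBlowup in
theorem mainTheorem2 {K : Type*} [Field K] (n : ℕ)
    (G : Finset (Ideal (MvPolynomial (Fin n) K)))
    (hG : MonomialBlowup.IsBuildingSetOfIdeals (G : Set (Ideal (MvPolynomial (Fin n) K)))) :
    MonomialBlowup.IsTame (∏ I ∈ G, I) := by
  classical
  let 𝒢 : Finset (Finset (Fin n)) := 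
    Finset.univ.filter fun A => coordinateIdeal K A ∈ G
  have hmem : ∀ A, A ∈ 𝒢 ↔ coordinateIdeal K A ∈ G := fun A => by simp [𝒢]
  have hprod : ∏ I ∈ G, I = ∏ A ∈ 𝒢, coordinateIdeal K A := by
    have himg : G = 𝒢.image (coordinateIdeal K) := by
      ext I
      rw [Finset.mem_image]
      constructor
      · intro hI
        obtain ⟨A, rfl⟩ := hG.coordinate I hI
        exact ⟨A, (hmem A).mpr hI, rfl⟩
      · rintro ⟨A, hA, rfl⟩
        exact (hmem A).mp hA
    conv_lhs => rw [himg]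
    exact Finset.prod_image fun A _ B _ h => coordinateIdeal_injective h
  rw [hprod]
  have : Nonempty (Fin n) := by
    obtain ⟨_, A, hA, rfl⟩ := hG.isBuildingSet.nonempty
    obtain ⟨i, -⟩ : A.Nonempty := by
      rw [Finset.nonempty_iff_ne_empty]
      rintro rfl
      exact hG.isBuildingSet.ne_bot _ ⟨∅, hA, rfl⟩ (by simp [coordinateSubspace])
    exact ⟨i⟩
  refine isTame_prod_coordinateIdeal fun A hA B hB hAB => ?_
  obtain ⟨i, hiA, hiB⟩ := Finset.not_disjoint_iff.mp hAB
  have hnd : ¬ Disjoint (coordinateSubspace K A) (coordinateSubspace K B) := by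
    intro hd
    have h0 := Submodule.disjoint_def.mp hd _ ((single_mem_coordinateSubspace_iff A i).mpr hiA)
      ((single_mem_coordinateSubspace_iff B i).mpr hiB)
    simpa using congrFun h0 i
  obtain ⟨C, hC, hABC⟩ := hG.isBuildingSet.sup_mem _ ⟨A, (hmem A).mp hA, rfl⟩ _
    ⟨B, (hmem B).mp hB, rfl⟩ hnd
  rw [← coordinateSubspace_union] at hABC
  rw [hmem, coordinateSubspace_injective hABC]
  exact hC
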